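/- Call a group $G$ \emph{hyperbolic} if it has a finite generating set $S$ whose word metric $d = d_S$ is Gromov hyperbolic, i.e. there is $\delta$ such that $d(x,y)+d(z,w)\le\max\{d(x,z)+d(y,w),\,d(x,w)+d(y,z)\}+2\delta$ for all $x,y,z,w\in G$. A group has the \emph{finitely generated intersection property} (FGIP) if the intersection of any two of its finitely generated subgroups is finitely generated. Let $G$ be a hyperbolic group and let $N\le G$ be a finitely generated infinite subgroup. Suppose that $tNt^{-1}\subseteq N$ for some $t\in G$ of infinite order with $\langle t\rangle\cap N=\{1_G\}$. Then $G$ does not have the FGIP: there exist finitely generated subgroups $H,K\le G$ such that $H\cap K$ is not finitely generated. -/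

import Mathlib

/-- The word distance on `G` with respect to `S`, that is, the path distance in the Cayley graph,
whose edges join `a` and `a * s` for `s ∈ S` and `a : G`.
It is only used for sets `S` that generate `G`, where the Cayley graph is connected. -/
noncomputable def wordDist {G : Type*} [Group G] (S : Set G) (g h : G) : ℕ :=
  (SimpleGraph.mulCayley S).dist g h

/-- Gromov's four-point condition with constant `δ` for a distance function `d`. -/
def FourPointHyperbolic {X : Type*} (d : X → X → ℕ) (δ : ℝ) : Prop :=
  ∀ x y z w : X,
    (d x y : ℝ) + d z w ≤ max ((d x z : ℝ) + d y w) ((d x w : ℝ) + d y z) + 2 * δ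

/-- A group is (word-, Gromov-) hyperbolic if it has a finite generating set whose word metric
is Gromov hyperbolic. -/
def IsHyperbolicGroup (G : Type*) [Group G] : Prop :=
  ∃ S : Finset G, Subgroup.closure (S : Set G) = ⊤ ∧
    ∃ δ : ℝ, FourPointHyperbolic (wordDist (S : Set G)) δ

/-- The finitely generated intersection property (also called the Howson property). -/
def HasFGIP (G : Type*) [Group G] : Prop :=
  ∀ H K : Subgroup G, H.FG → K.FG → (H ⊓ K).FG

/-- The Cayley graph with respect to a generating set is connected, so that `wordDist` takes no
default values there. -/
theorem mulCayley_connected_of_closure_eq_top {G : Type*} [Group G] {S : Set G}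
    (hS : Subgroup.closure S = ⊤) : (SimpleGraph.mulCayley S).Connected := by
  have step : ∀ g s : G, s ∈ S → (SimpleGraph.mulCayley S).Reachable g (g * s) := by
    intro g s hs
    by_cases h : g = g * s
    · rw [← h]
    · exact SimpleGraph.Adj.reachable
        ((SimpleGraph.mulCayley_adj' S g (g * s)).2 ⟨h, s, hs, Or.inl rfl⟩)
  have key : ∀ a : G, ∀ g : G, (SimpleGraph.mulCayley S).Reachable g (g * a) := by
    intro a
    have ha : a ∈ Subgroup.closure S := by rw [hS]; trivial
    induction ha using Subgroup.closure_induction with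
    | mem s hs => exact fun g => step g s hs
    | one => intro g; rw [mul_one]
    | mul x y _ _ hx hy =>
      intro g
      rw [← mul_assoc]
      exact (hx g).trans (hy _)
    | inv x _ hx =>
      intro g
      have := hx (g * x⁻¹)
      rw [inv_mul_cancel_right] at this
      exact this.symm
  have : Nonempty G := ⟨1⟩
  refine SimpleGraph.Connected.mk ?_
  intro g h
  have := key (g⁻¹ * h) g
  rwa [mul_inv_cancel_left] at this

/-!
If `s` conjugates `N` into itself, `⟨s⟩ ∩ N = 1`, and the conjugates `h₁ s h₁⁻¹`, `h₂ s h₂⁻¹` by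
elements of `N` are free generators of a subgroup `F`, then `F ∩ N` is not finitely generated. It
consists of words of exponent sum zero, since `s` normalizes the union of the `s⁻ᵖ N sᵖ`, which
still meets `⟨s⟩` trivially. It contains the conjugates of `h₂ s h₂⁻¹ (h₁ s h₁⁻¹)⁻¹` by all
nonnegative powers of `h₁ s h₁⁻¹`, and no finitely generated group of words of exponent sum zero
does: under a homomorphism from `F` to `ℚ ⋊ ℤ` these conjugates map to the elements `2⁻ʲ` of `ℚ`,
which have no common denominator.

Such free generators come from ping-pong. Some power of `t` acts on the hyperbolic space as a
translation along a quasi-axis. As `N` is infinite and `⟨t⟩ ∩ N = 1`, some `g ∈ N` commutes with no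
positive power of `t`. Then the axes of `t` and `g t g⁻¹` diverge: otherwise, by uniform properness,
`g tᵖ g⁻¹` would be a power of `t` for some `p ≠ 0`, and since `g tⁿ g⁻¹ t⁻ⁿ ∈ N` this forces `g` to
commute with a power of `t`. So `tᵏ` and `g tᵏ g⁻¹` are free generators for large `k`.
-/

/-- Gromov's four-point condition with constant `δ`, for a pseudometric space. -/
def IsGromovHyperbolic (X : Type*) [PseudoMetricSpace X] (δ : ℝ) : Prop :=
  ∀ x y z w : X, dist x y + dist z w ≤ max (dist x z + dist y w) (dist x w + dist y z) + 2 * δ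

/-- Every two points have a midpoint up to an additive error `C`: a weak form of being a length
space that holds in the vertex set of a connected graph. -/
def HasRoughMidpoints (X : Type*) [PseudoMetricSpace X] (C : ℝ) : Prop :=
  ∀ x y : X, ∃ m, dist x m ≤ dist x y / 2 + C ∧ dist m y ≤ dist x y / 2 + C

/-- An action is uniformly proper if the number of group elements that move a point by at most `r`
is bounded in terms of `r` alone. -/
def IsUniformlyProper (G X : Type*) [Group G] [PseudoMetricSpace X] [MulAction G X] : Prop :=
  ∀ r : ℝ, ∃ n : ℕ, ∀ x : X, {g : G | dist x (g • x) ≤ r}.encard ≤ n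

namespace IsGromovHyperbolic

variable {X : Type*} [PseudoMetricSpace X] {δ : ℝ}

theorem nonneg (h : IsGromovHyperbolic X δ) (x : X) : 0 ≤ δ := by
  have := h x x x x
  simp only [dist_self, add_zero, max_self, zero_add] at this
  linarith

theorem le_or_le (h : IsGromovHyperbolic X δ) (x y z w : X) :
    dist x y + dist z w ≤ dist x z + dist y w + 2 * δ ∨
      dist x y + dist z w ≤ dist x w + dist y z + 2 * δ := by
  simpa only [← max_add_add_right, le_max_iff] using h x y z w

theorem between_of_near (h : IsGromovHyperbolic X δ) {p q p' q' z : X} {E r : ℝ}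
    (hz : dist p' z + dist z q' ≤ dist p' q' + E) (hp : dist p p' ≤ r) (hq : dist q q' ≤ r)
    (hpz : E + r + 4 * δ < dist p' z) (hzq : E + r + 4 * δ < dist z q') :
    dist p z + dist z q ≤ dist p q + E + 4 * δ := by
  have hδ := h.nonneg p
  have hz' : dist p z + dist z q' ≤ dist p q' + E + 2 * δ := by
    rcases h.le_or_le z p p' q' with h1 | h1 <;>
      linarith [dist_comm z p, dist_comm z p', @dist_nonneg _ _ p z]
  rcases h.le_or_le z q p q' with h1 | h1 <;>
    linarith [dist_comm z p, dist_comm q p, @dist_nonneg _ _ z q]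

theorem dist_le_of_between (h : IsGromovHyperbolic X δ) {p q z w : X} {E : ℝ}
    (hz : dist p z + dist z q ≤ dist p q + E) (hw : dist p w + dist w q ≤ dist p q + E) :
    dist z w ≤ |dist p z - dist p w| + E + 2 * δ := by
  rcases h.le_or_le p q z w with h1 | h1 <;>
    linarith [dist_comm q z, dist_comm q w, le_abs_self (dist p z - dist p w),
      neg_abs_le (dist p z - dist p w)]

theorem dist_isometry_le (h : IsGromovHyperbolic X δ) {f : X → X} (hf : Isometry f)
    {p q m : X} {r E : ℝ} (hp : dist p (f p) ≤ r) (hq : dist q (f q) ≤ r)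
    (hm : dist p m + dist m q ≤ dist p q + E)
    (hpm : E + r + 4 * δ < dist p m) (hmq : E + r + 4 * δ < dist m q) :
    dist m (f m) ≤ |dist p m - dist p (f m)| + E + 6 * δ := by
  have hδ := h.nonneg p
  have hfm : dist p (f m) + dist (f m) q ≤ dist p q + E + 4 * δ := by
    apply h.between_of_near (p' := f p) (q' := f q) (r := r) _ hp hq <;>
      simpa only [hf.dist_eq]
  have := h.dist_le_of_between (E := E + 4 * δ) (z := m) (by linarith)
    (hfm.trans_eq (add_assoc _ _ _))
  linarith

/-- Far from the endpoints of a segment whose endpoints it moves little, an isometry acts like a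
translation along the segment. -/
theorem two_mul_dist_isometry_le (h : IsGromovHyperbolic X δ) {f : X → X} (hf : Isometry f)
    {p q m : X} {r E : ℝ} (hp : dist p (f p) ≤ r) (hq : dist q (f q) ≤ r)
    (hm : dist p m + dist m q ≤ dist p q + E)
    (hpm : E + 2 * r + 4 * δ < dist p m) (hmq : E + 2 * r + 4 * δ < dist m q) :
    2 * dist m (f m) ≤ dist m (f (f m)) + 2 * E + 14 * δ := by
  have hδ := h.nonneg p
  have hr : 0 ≤ r := dist_nonneg.trans hp
  have hE : 0 ≤ E := by linarith [dist_triangle p m q]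
  have hD := h.dist_isometry_le hf hp hq hm (by linarith) (by linarith)
  have hmove : |dist p m - dist p (f m)| ≤ r := by
    rw [← hf.dist_eq p m]
    exact (abs_dist_sub_le _ _ _).trans ((dist_comm _ _).trans_le hp)
  have hle : dist p m ≤ dist p (f m) + r := by linarith [le_abs_self (dist p m - dist p (f m))]
  have hfp : dist (f p) (f m) = dist p m := hf.dist_eq p m
  have hfp' : dist (f p) (f (f m)) = dist p (f m) := hf.dist_eq p (f m)
  have hD' : dist (f m) (f (f m)) = dist m (f m) := hf.dist_eq m (f m)
  have hupper : dist p (f (f m)) + dist p m ≤ 2 * dist p (f m) + 2 * δ := by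
    rcases h.le_or_le p (f (f m)) (f p) (f m) with h1 | h1 <;>
      linarith [dist_comm (f (f m)) (f m), dist_comm (f (f m)) (f p)]
  have hlower : 2 * dist p (f m) ≤ dist p (f (f m)) + dist p m + 2 * δ := by
    rcases h.le_or_le p (f m) (f p) (f (f m)) with h1 | h1 <;>
      linarith [dist_comm (f m) (f p)]
  rcases abs_cases (dist p m - dist p (f m)) with ⟨h1, -⟩ | ⟨h1, -⟩ <;>
    linarith [dist_triangle p m (f (f m)), dist_triangle_right p m (f (f m))]

end IsGromovHyperbolic

section IsometricAction

variable {G X : Type*} [Group G] [PseudoMetricSpace X] [MulAction G X]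

theorem IsUniformlyProper.finite_setOf_dist_smul_le (hG : IsUniformlyProper G X) (x : X) (r : ℝ) :
    {g : G | dist x (g • x) ≤ r}.Finite :=
  have ⟨_, hn⟩ := hG r
  Set.finite_of_encard_le_coe (hn x)

theorem IsUniformlyProper.exists_lt_dist_pow_smul (hG : IsUniformlyProper G X) {t : G}
    (ht : ¬ IsOfFinOrder t) (x : X) (r : ℝ) : ∃ n : ℕ, r < dist x (t ^ n • x) := by
  by_contra! hbounded
  exact Set.infinite_range_of_injective (injective_pow_iff_not_isOfFinOrder.2 ht)
    ((hG.finite_setOf_dist_smul_le x r).subset (Set.range_subset_iff.2 hbounded))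

variable [IsIsometricSMul G X]

theorem dist_inv_smul_self (g : G) (x : X) : dist x (g⁻¹ • x) = dist x (g • x) := by
  rw [← dist_smul g, smul_inv_smul, dist_comm]

theorem dist_pow_smul_pow_add_smul (t : G) (i n : ℕ) (x : X) :
    dist (t ^ i • x) (t ^ (i + n) • x) = dist x (t ^ n • x) := by
  rw [pow_add, mul_smul, dist_smul]

theorem dist_pow_smul_le (t : G) (n : ℕ) (x : X) : dist x (t ^ n • x) ≤ n * dist x (t • x) := by
  induction n with
  | zero => simp
  | succ n ih =>
    have hstep := dist_pow_smul_pow_add_smul t n 1 x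
    rw [pow_one] at hstep
    push_cast
    linarith [dist_triangle x (t ^ n • x) (t ^ (n + 1) • x)]

/-- Otherwise too many powers of `t` move the midpoint of a long segment from `o` to `t ^ N • o`
by a bounded amount only. -/
theorem exists_dist_pow_smul_add_le {δ C : ℝ} (h : IsGromovHyperbolic X δ)
    (hmid : HasRoughMidpoints X C) (hG : IsUniformlyProper G X) {t : G} (ht : ¬ IsOfFinOrder t)
    (o : X) (A : ℝ) :
    ∃ (i : ℕ) (x : X), 0 < i ∧ dist x (t ^ i • x) + A ≤ dist x (t ^ (2 * i) • x) := by
  by_contra! hsmall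
  obtain ⟨n, hn⟩ := hG (|A| + 4 * C + 14 * δ)
  have hδ := h.nonneg o
  set r : ℝ := n * dist o (t • o)
  obtain ⟨N, hN⟩ := hG.exists_lt_dist_pow_smul ht o (2 * (3 * C + 2 * r + 4 * δ))
  obtain ⟨m, hm₁, hm₂⟩ := hmid o (t ^ N • o)
  have hm := dist_triangle o m (t ^ N • o)
  have hmove : ∀ i ≤ n, dist m (t ^ i • m) ≤ |A| + 4 * C + 14 * δ := by
    intro i hi
    rcases i.eq_zero_or_pos with rfl | hpos
    · rw [pow_zero, one_smul, dist_self]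
      linarith [abs_nonneg A]
    have hr : dist o (t ^ i • o) ≤ r :=
      (dist_pow_smul_le t i o).trans
        (mul_le_mul_of_nonneg_right (Nat.cast_le.2 hi) dist_nonneg)
    have hr' : dist (t ^ N • o) (t ^ i • t ^ N • o) ≤ r := by
      rwa [smul_smul, pow_mul_comm, mul_smul, dist_smul]
    have := h.two_mul_dist_isometry_le (m := m) (E := 2 * C) (isometry_smul X (t ^ i)) hr hr'
      (by linarith) (by linarith) (by linarith)
    rw [smul_smul, ← pow_add, ← two_mul] at this
    linarith [hsmall i m hpos, le_abs_self A]
  have hinj : Function.Injective (t ^ · : ℕ → G) := injective_pow_iff_not_isOfFinOrder.2 ht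
  have hsub : (t ^ · : ℕ → G) '' Set.Iic n ⊆ {g | dist m (g • m) ≤ |A| + 4 * C + 14 * δ} :=
    Set.image_subset_iff.2 hmove
  have hcard := (Set.encard_le_encard hsub).trans (hn m)
  rw [hinj.encard_image, ← Finset.coe_Iic, Set.encard_coe_eq_coe_finsetCard, Nat.card_Iic] at hcard
  exact n.lt_irrefl (by exact_mod_cast hcard)

end IsometricAction

section PingPong

variable {G X α : Type*} [Group G]

/-- The value in `G` of the letter `(a, e)` of a word in a free group, when the generator `a` is
sent to `f a`: the letter stands for `a` if `e` is true, and for `a⁻¹` otherwise. -/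
def letterValue (f : α → G) (x : α × Bool) : G :=
  cond x.2 (f x.1) (f x.1)⁻¹

theorem inv_letterValue (f : α → G) (x : α × Bool) :
    (letterValue f x)⁻¹ = letterValue f (x.1, !x.2) := by
  rcases x with ⟨a, _ | _⟩ <;> simp [letterValue]

variable [PseudoMetricSpace X] [MulAction G X] [IsIsometricSMul G X]

theorem dist_letterValue_const_pow_smul (t : G) (x : α × Bool) (n : ℕ) (o : X) :
    dist o (letterValue (fun _ => t) x ^ n • o) = dist o (t ^ n • o) := by
  rcases x with ⟨a, _ | _⟩
  · rw [letterValue, cond_false, inv_pow, dist_inv_smul_self]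
  · rfl

namespace IsGromovHyperbolic

variable {δ : ℝ}

theorem dist_prod_smul_add_le (h : IsGromovHyperbolic X δ) (o : X) {c : ℝ} (hc : 0 < c)
    (g : G) (l : List G) (hlen : ∀ x ∈ g :: l, c ≤ dist o (x • o))
    (hturn : (g :: l).IsChain fun x y =>
      max (dist o (x • o)) (dist o (y • o)) + 2 * δ + c ≤ dist o ((x * y) • o)) :
    dist o (l.prod • o) + c ≤ dist o ((g :: l).prod • o) := by
  induction l generalizing g with
  | nil => simpa using hlen
  | cons g' l ih =>
    obtain ⟨hgg', hturn⟩ := List.isChain_cons_cons.1 hturn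
    have hl := ih g' (fun x hx => hlen x (List.mem_cons_of_mem _ hx)) hturn
    have hg := le_max_left (dist o (g • o)) (dist o (g' • o))
    have hg' := le_max_right (dist o (g • o)) (dist o (g' • o))
    have hfour := h.le_or_le o ((g * g') • o) (g • o) ((g :: g' :: l).prod • o)
    simp only [List.prod_cons, mul_smul, dist_smul, dist_comm (g' • o) o] at *
    rcases hfour with hfour | hfour <;> linarith

/-- A ping-pong criterion: as the orbit points of distinct letters are far apart, the orbit of a
reduced word moves away from the base point at every letter. -/
theorem lift_injective (h : IsGromovHyperbolic X δ) (o : X) {f : α → G}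
    (hf : ∀ x y, x ≠ y →
      max (dist o (letterValue f x • o)) (dist o (letterValue f y • o)) + 2 * δ + 1 ≤
        dist (letterValue f x • o) (letterValue f y • o)) :
    Function.Injective (FreeGroup.lift f) := by
  classical
  have hδ := h.nonneg o
  have hinv (x : α × Bool) :
      dist o (letterValue f (x.1, !x.2) • o) = dist o (letterValue f x • o) := by
    rw [← inv_letterValue, dist_inv_smul_self]
  have hlen (x : α × Bool) : 1 ≤ dist o (letterValue f x • o) := by
    have hx := hf x (x.1, !x.2) fun hx => by simpa using congrArg Prod.snd hx
    rw [hinv, max_self] at hx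
    linarith [dist_triangle_left (letterValue f x • o) (letterValue f (x.1, !x.2) • o) o, hinv x]
  have hturn {x y : α × Bool} (hxy : x.1 = y.1 → x.2 = y.2) :
      max (dist o (letterValue f x • o)) (dist o (letterValue f y • o)) + 2 * δ + 1 ≤
        dist o ((letterValue f x * letterValue f y) • o) := by
    have := hf (x.1, !x.2) y fun hx => by simp [← hx] at hxy
    rwa [hinv, ← inv_letterValue, ← dist_smul (letterValue f x) (_ • o), smul_inv_smul,
      smul_smul] at this
  refine (injective_iff_map_eq_one _).2 fun w hw => FreeGroup.toWord_eq_nil_iff.1 ?_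
  by_contra hne
  obtain ⟨x, l, hxl⟩ := List.exists_cons_of_ne_nil hne
  have hred : (x :: l).IsChain fun x y => x.1 = y.1 → x.2 = y.2 :=
    hxl ▸ FreeGroup.isReduced_toWord
  have hgrow := h.dist_prod_smul_add_le o one_pos (letterValue f x) (l.map (letterValue f))
    (List.forall_mem_map (l := x :: l).2 fun y _ => hlen y)
    ((List.isChain_map (l := x :: l) _).2 (hred.imp fun _ _ => hturn))
  have hprod : ((x :: l).map (letterValue f)).prod = 1 := by
    rw [← hw, ← FreeGroup.mk_toWord (x := w), hxl, FreeGroup.lift_mk]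
    rfl
  rw [← List.map_cons, hprod, one_smul, dist_self] at hgrow
  linarith [@dist_nonneg _ _ o ((l.map (letterValue f)).prod • o)]

end IsGromovHyperbolic

end PingPong

/-- The orbit `n ↦ t ^ n • o` is a rough geodesic ray, with additive error `dist o (t • o)`, along
which the distance to `o` grows at least linearly. -/
structure IsRoughAxis {G X : Type*} [Group G] [PseudoMetricSpace X] [MulAction G X]
    (o : X) (t : G) : Prop where
  le_dist : ∀ n : ℕ, (n : ℝ) ≤ dist o (t ^ n • o)
  dist_add_dist_le : ∀ m n : ℕ,
    dist o (t ^ m • o) + dist o (t ^ n • o) ≤ dist o (t ^ (m + n) • o) + dist o (t • o)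

theorem IsRoughAxis.tendsto_dist_pow_smul {G X : Type*} [Group G] [PseudoMetricSpace X]
    [MulAction G X] {o : X} {t : G} (ht : IsRoughAxis o t) :
    Filter.Tendsto (fun n : ℕ => dist o (t ^ n • o)) Filter.atTop Filter.atTop :=
  Filter.tendsto_atTop_mono ht.le_dist tendsto_natCast_atTop_atTop

section RoughAxis

variable {G X : Type*} [Group G] [PseudoMetricSpace X] [MulAction G X] [IsIsometricSMul G X]
  {o : X} {t : G} {δ : ℝ}

theorem IsGromovHyperbolic.dist_pow_smul_add_le (h : IsGromovHyperbolic X δ)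
    (ht : dist o (t • o) + 4 * δ + 1 ≤ dist o (t ^ 2 • o)) (n : ℕ) :
    dist o (t ^ n • o) + (2 * δ + 1) ≤ dist o (t ^ (n + 1) • o) := by
  have hδ := h.nonneg o
  have htwo := dist_pow_smul_le t 2 o
  push_cast at htwo
  have := h.dist_prod_smul_add_le (c := 2 * δ + 1) o (by linarith) t (List.replicate n t)
  simp only [← List.replicate_succ, List.prod_replicate] at this
  refine this (fun x hx => ?_) (List.isChain_replicate_of_rel _ ?_)
  · rw [List.eq_of_mem_replicate hx]
    linarith
  · rw [max_self, ← pow_two]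
    linarith

theorem IsGromovHyperbolic.isRoughAxis (h : IsGromovHyperbolic X δ)
    (ht : dist o (t • o) + 4 * δ + 1 ≤ dist o (t ^ 2 • o)) : IsRoughAxis o t := by
  have hδ := h.nonneg o
  have hstep := h.dist_pow_smul_add_le ht
  refine ⟨fun n => ?_, fun m n => ?_⟩
  · induction n with
    | zero => simp
    | succ n ih =>
      push_cast
      linarith [hstep n]
  · cases m with
    | zero => simp
    | succ m =>
      have hm := dist_pow_smul_pow_add_smul t m 1 o
      have hn : dist (t ^ m • o) (t ^ (m + 1 + n) • o) = dist o (t ^ (n + 1) • o) := by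
        rw [add_assoc, add_comm 1 n, dist_pow_smul_pow_add_smul]
      have hn' := dist_pow_smul_pow_add_smul t (m + 1) n o
      rw [pow_one] at hm
      rcases h.le_or_le (t ^ m • o) (t ^ (m + 1 + n) • o) o (t ^ (m + 1) • o) with h1 | h1 <;>
        linarith [hstep m, hstep n, dist_comm (t ^ m • o) o,
          dist_comm (t ^ (m + 1 + n) • o) (t ^ (m + 1) • o), dist_comm (t ^ (m + 1 + n) • o) o]

theorem exists_abs_dist_pow_smul_sub_le (o : X) (t : G) {s E : ℝ} (hs : 0 ≤ s) (hE : 0 ≤ E)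
    {b : ℕ} (hb : s ≤ dist o (t ^ b • o) + E) :
    ∃ c ≤ b, |dist o (t ^ c • o) - s| ≤ dist o (t • o) + E := by
  induction b with
  | zero =>
    refine ⟨0, le_rfl, ?_⟩
    rw [pow_zero, one_smul, dist_self] at hb ⊢
    rw [zero_sub, abs_neg, abs_of_nonneg hs]
    linarith [@dist_nonneg _ _ o (t • o)]
  | succ b ih =>
    rcases le_or_gt s (dist o (t ^ b • o) + E) with hle | hlt
    · obtain ⟨c, hc, hcs⟩ := ih hle
      exact ⟨c, hc.trans b.le_succ, hcs⟩
    · refine ⟨b + 1, le_rfl, ?_⟩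
      have hstep := dist_pow_smul_pow_add_smul t b 1 o
      rw [pow_one] at hstep
      rw [abs_le]
      constructor <;> linarith [dist_triangle o (t ^ b • o) (t ^ (b + 1) • o),
        @dist_nonneg _ _ o (t • o)]

namespace IsRoughAxis

theorem exists_dist_pow_smul_le (ht : IsRoughAxis o t) (h : IsGromovHyperbolic X δ) {z : X} {b : ℕ}
    {E : ℝ} (hz : dist o z + dist z (t ^ b • o) ≤ dist o (t ^ b • o) + E) :
    ∃ c : ℕ, dist z (t ^ c • o) ≤ 2 * dist o (t • o) + 2 * E + 2 * δ := by
  have hE : 0 ≤ E := by linarith [dist_triangle o z (t ^ b • o)]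
  obtain ⟨c, hcb, hc⟩ := exists_abs_dist_pow_smul_sub_le o t (@dist_nonneg _ _ o z) hE (b := b)
    (by linarith [@dist_nonneg _ _ z (t ^ b • o)])
  obtain ⟨e, rfl⟩ := Nat.exists_eq_add_of_le hcb
  refine ⟨c, ?_⟩
  have hadd := ht.dist_add_dist_le c e
  rw [← dist_pow_smul_pow_add_smul t c e] at hadd
  have := h.dist_le_of_between (E := dist o (t • o) + E) (w := t ^ c • o)
    (hz.trans (by linarith [@dist_nonneg _ _ o (t • o)])) (by linarith)
  rw [abs_sub_comm] at this
  linarith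

/-- Left multiplication by `g` moves all points `t ^ (p * n) • o` by the same amount, so `g • o` is
carried by a large such power of `t` to a point between two orbit points of `t`. -/
theorem exists_dist_zpow_smul_le_of_commute (ht : IsRoughAxis o t) (h : IsGromovHyperbolic X δ)
    {g : G} {p : ℕ} (hp : 0 < p) (hg : Commute g (t ^ p)) :
    ∃ c : ℤ, dist (g • o) (t ^ c • o) ≤ 4 * dist o (t • o) + 10 * δ := by
  obtain ⟨n, hn⟩ := exists_nat_gt (dist o (t • o) + dist o (g • o) + 4 * δ)
  have hlarge : (n : ℝ) ≤ dist o (t ^ (p * n) • o) :=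
    le_trans (Nat.cast_le.2 (Nat.le_mul_of_pos_left n hp)) (ht.le_dist _)
  set b := p * n
  have hcomm : Commute g (t ^ b) := pow_mul t p n ▸ hg.pow_right n
  have hb : dist (g • o) (t ^ b • g • o) = dist o (t ^ b • o) := by
    rw [smul_smul, ← hcomm.eq, mul_smul, dist_smul]
  have hb' : dist (t ^ b • g • o) (t ^ (b + b) • g • o) = dist o (t ^ b • o) := by
    rw [pow_add, mul_smul, dist_smul, hb]
  have hbb : dist (g • o) (t ^ (b + b) • g • o) = dist o (t ^ (b + b) • o) := by
    rw [smul_smul, pow_add, ← (hcomm.mul_right hcomm).eq, mul_smul, dist_smul]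
  have hbetween := h.between_of_near (E := dist o (t • o)) (p := o) (q := t ^ (b + b) • o)
    (by linarith [ht.dist_add_dist_le b b] :
      dist (g • o) (t ^ b • g • o) + dist (t ^ b • g • o) (t ^ (b + b) • g • o) ≤ _)
    le_rfl (dist_smul _ _ _).le (by linarith) (by linarith)
  obtain ⟨c, hc⟩ := ht.exists_dist_pow_smul_le h (hbetween.trans_eq (add_assoc _ _ _))
  refine ⟨-(b : ℤ) + c, ?_⟩
  rw [← dist_smul (t ^ b), zpow_add, zpow_neg, zpow_natCast, zpow_natCast, mul_smul, smul_inv_smul]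
  linarith

end IsRoughAxis

end RoughAxis

section FreeSubgroups

variable {G X : Type*} [Group G] [PseudoMetricSpace X] [MulAction G X] [IsIsometricSMul G X]
  {o : X} {δ : ℝ}

theorem IsUniformlyProper.exists_ne_mul_inv_mem (hG : IsUniformlyProper G X) {ι : Type*}
    [Infinite ι] (H : Subgroup G) (f : ι → G) (r : ℝ)
    (hf : ∀ i, ∃ h ∈ H, dist (f i • o) (h • o) ≤ r) : ∃ i j, i ≠ j ∧ f i * (f j)⁻¹ ∈ H := by
  choose h hH hr using hf
  have hmem (i : ι) : (h i)⁻¹ * f i ∈ {g : G | dist o (g • o) ≤ r} := by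
    rw [Set.mem_ofPred_eq, ← dist_smul (h i), smul_smul, mul_inv_cancel_left, dist_comm]
    exact hr i
  obtain ⟨i, -, j, -, hij, heq⟩ := Set.infinite_univ.exists_ne_map_eq_of_mapsTo
    (fun i _ => hmem i) (hG.finite_setOf_dist_smul_le o r)
  refine ⟨i, j, hij, ?_⟩
  rw [inv_mul_eq_iff_eq_mul] at heq
  rw [heq, mul_assoc, mul_assoc, mul_inv_cancel, mul_one]
  exact H.mul_mem (hH i) (H.inv_mem (hH j))

namespace IsRoughAxis

variable {t u v : G}

theorem letterValue_const (ht : IsRoughAxis o t) {α : Type*} (x : α × Bool) :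
    IsRoughAxis o (letterValue (fun _ => t) x) where
  le_dist n := (ht.le_dist n).trans_eq (dist_letterValue_const_pow_smul t x n o).symm
  dist_add_dist_le m n := by
    have hlen := dist_letterValue_const_pow_smul t x 1 o
    rw [pow_one, pow_one] at hlen
    simpa only [dist_letterValue_const_pow_smul, hlen] using ht.dist_add_dist_le m n

theorem dist_smul_pow_smul_add_dist_le (hv : IsRoughAxis o v) (h : IsGromovHyperbolic X δ) {g : G}
    {n k : ℕ} {q : X} {C : ℝ} (hnk : n ≤ k) (hq : dist o q = dist o (v ^ k • o))
    (hqk : dist q (g • v ^ k • o) ≤ dist o (v ^ k • o) + C)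
    (hlarge : 2 * dist o (v ^ n • o) + C + 3 * dist o (g • o) + 2 * δ < dist o (v ^ k • o)) :
    dist o (g • v ^ n • o) + dist (g • v ^ n • o) q ≤
      dist o q + (dist o (v • o) + 2 * dist o (g • o) + 2 * δ) := by
  obtain ⟨e, rfl⟩ := Nat.exists_eq_add_of_le hnk
  have hadd := hv.dist_add_dist_le n e
  have hrest : dist (g • v ^ n • o) (g • v ^ (n + e) • o) = dist o (v ^ e • o) := by
    rw [dist_smul, dist_pow_smul_pow_add_smul]
  have hupper (x : X) : dist o (g • x) ≤ dist o (g • o) + dist o x :=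
    (dist_triangle _ _ _).trans_eq (by rw [dist_smul])
  have hlower (x : X) : dist o x ≤ dist o (g • o) + dist o (g • x) := by
    rw [← dist_smul g o x]
    exact dist_triangle_left _ _ _
  have hqn := dist_triangle o (g • v ^ n • o) q
  rcases h.le_or_le q (g • v ^ n • o) (g • v ^ (n + e) • o) o with h1 | h1 <;>
    linarith [hupper (v ^ n • o), hlower (v ^ (n + e) • o), dist_comm q (g • v ^ n • o),
      dist_comm (g • v ^ (n + e) • o) o, dist_comm (g • v ^ n • o) o, dist_comm q o,
      dist_comm (g • v ^ (n + e) • o) (g • v ^ n • o)]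

/-- Otherwise every `g • v ^ n • o` is near the orbit of `u`, and two of the elements
`(u ^ m)⁻¹ * g * v ^ n` agree by properness. -/
theorem eventually_add_le_dist (hu : IsRoughAxis o u) (hv : IsRoughAxis o v)
    (h : IsGromovHyperbolic X δ) (hG : IsUniformlyProper G X)
    (hlen : ∀ n : ℕ, dist o (u ^ n • o) = dist o (v ^ n • o)) {g : G}
    (hg : ∀ p : ℤ, p ≠ 0 → g * v ^ p * g⁻¹ ∉ Subgroup.zpowers u) (C : ℝ) :
    ∀ᶠ k : ℕ in Filter.atTop, dist o (v ^ k • o) + C ≤ dist (u ^ k • o) (g • v ^ k • o) := by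
  by_contra hfar
  rw [Filter.not_eventually] at hfar
  set E : ℝ := dist o (v • o) + 2 * dist o (g • o) + 2 * δ
  have hnear (n : ℕ) : ∃ x ∈ Subgroup.zpowers u,
      dist ((g * v ^ n) • o) (x • o) ≤ 2 * dist o (u • o) + 2 * E + 2 * δ := by
    obtain ⟨k, hk, hnk, hlarge⟩ := (hfar.and_eventually ((Filter.eventually_ge_atTop n).and
      (hv.tendsto_dist_pow_smul.eventually_gt_atTop
        (2 * dist o (v ^ n • o) + C + 3 * dist o (g • o) + 2 * δ)))).exists
    obtain ⟨m, hm⟩ := hu.exists_dist_pow_smul_le h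
      (hv.dist_smul_pow_smul_add_dist_le h hnk (hlen k) (not_le.1 hk).le hlarge)
    exact ⟨u ^ m, ⟨m, zpow_natCast u m⟩, by rwa [mul_smul]⟩
  obtain ⟨i, j, hij, hmem⟩ := hG.exists_ne_mul_inv_mem _ _ _ hnear
  refine hg (i - j) (sub_ne_zero.2 (Nat.cast_injective.ne hij)) ?_
  simpa only [zpow_sub, zpow_natCast, mul_inv_rev, mul_assoc] using hmem

variable {α : Type*} {f : α → G}

theorem eventually_add_le_dist_letterValue (ht : IsRoughAxis o t)
    (h : IsGromovHyperbolic X δ) (hG : IsUniformlyProper G X)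
    (hf : ∀ a b, a ≠ b → ∀ p : ℤ, p ≠ 0 →
      (f a)⁻¹ * f b * t ^ p * ((f a)⁻¹ * f b)⁻¹ ∉ Subgroup.zpowers t)
    {x y : α × Bool} (hxy : x ≠ y) (C : ℝ) :
    ∀ᶠ k : ℕ in Filter.atTop, dist o (t ^ k • o) + C ≤
      dist (f x.1 • letterValue (fun _ => t) x ^ k • o)
        (f y.1 • letterValue (fun _ => t) y ^ k • o) := by
  obtain ⟨a, e⟩ := x
  obtain ⟨b, e'⟩ := y
  rcases eq_or_ne a b with rfl | hab
  · filter_upwards [ht.tendsto_dist_pow_smul.eventually_ge_atTop (C + dist o (t • o))] with k hk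
    obtain rfl : e' = !e := by
      cases e <;> cases e' <;> simp_all
    have hopp : dist (letterValue (fun _ => t) (a, e) ^ k • o)
        (letterValue (fun _ => t) (a, !e) ^ k • o) = dist o (t ^ (k + k) • o) := by
      rw [← inv_letterValue _ (a, e), dist_comm, inv_pow,
        ← dist_smul (letterValue (fun _ => t) (a, e) ^ k), smul_inv_smul, smul_smul, ← pow_add,
        dist_letterValue_const_pow_smul]
    rw [dist_smul, hopp]
    linarith [ht.dist_add_dist_le k k]
  · have hne : ∀ p : ℤ, p ≠ 0 → (f a)⁻¹ * f b * letterValue (fun _ : α => t) (b, e') ^ p *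
        ((f a)⁻¹ * f b)⁻¹ ∉ Subgroup.zpowers (letterValue (fun _ : α => t) (a, e)) := by
      have hzpowers : Subgroup.zpowers (letterValue (fun _ : α => t) (a, e)) =
          Subgroup.zpowers t := by
        cases e <;> simp [letterValue]
      intro p hp
      rw [hzpowers]
      cases e'
      · simpa [letterValue] using hf a b hab (-p) (neg_ne_zero.2 hp)
      · exact hf a b hab p hp
    filter_upwards [(ht.letterValue_const (a, e)).eventually_add_le_dist
      (ht.letterValue_const (b, e')) h hG
      (fun n => by simp only [dist_letterValue_const_pow_smul]) hne C] with k hk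
    rwa [dist_letterValue_const_pow_smul, mul_smul, ← dist_smul (f a) (_ ^ k • o),
      smul_inv_smul] at hk

theorem eventually_lift_injective [Finite α] (ht : IsRoughAxis o t)
    (h : IsGromovHyperbolic X δ) (hG : IsUniformlyProper G X)
    (hf : ∀ a b, a ≠ b → ∀ p : ℤ, p ≠ 0 →
      (f a)⁻¹ * f b * t ^ p * ((f a)⁻¹ * f b)⁻¹ ∉ Subgroup.zpowers t) :
    ∀ᶠ k : ℕ in Filter.atTop,
      Function.Injective (FreeGroup.lift fun a => f a * t ^ k * (f a)⁻¹) := by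
  have hfar : ∀ᶠ k : ℕ in Filter.atTop, ∀ x y : α × Bool, x ≠ y → dist o (t ^ k • o) +
      (2 * δ + 1 + 3 * (dist o (f x.1 • o) + dist o (f y.1 • o))) ≤
        dist (f x.1 • letterValue (fun _ => t) x ^ k • o)
          (f y.1 • letterValue (fun _ => t) y ^ k • o) := by
    simp only [Filter.eventually_all]
    exact fun x y hxy => ht.eventually_add_le_dist_letterValue h hG hf hxy _
  filter_upwards [hfar] with k hk
  have hletter (x : α × Bool) : letterValue (fun a => f a * t ^ k * (f a)⁻¹) x =
      f x.1 * letterValue (fun _ => t) x ^ k * (f x.1)⁻¹ := by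
    rcases x with ⟨a, _ | _⟩ <;> simp [letterValue, mul_assoc]
  have hclose (x : α × Bool) :
      dist (f x.1 • letterValue (fun _ => t) x ^ k • o)
        (letterValue (fun a => f a * t ^ k * (f a)⁻¹) x • o) = dist o (f x.1 • o) := by
    rw [hletter, mul_smul, mul_smul, dist_smul, dist_smul, dist_inv_smul_self]
  have hlen (x : α × Bool) : dist o (letterValue (fun a => f a * t ^ k * (f a)⁻¹) x • o) ≤
      dist o (t ^ k • o) + 2 * dist o (f x.1 • o) := by
    have h1 := dist_triangle o (f x.1 • o) (f x.1 • letterValue (fun _ => t) x ^ k • o)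
    rw [dist_smul, dist_letterValue_const_pow_smul] at h1
    linarith [dist_triangle o (f x.1 • letterValue (fun _ => t) x ^ k • o)
      (letterValue (fun a => f a * t ^ k * (f a)⁻¹) x • o), hclose x]
  refine h.lift_injective o fun x y hxy => ?_
  have hmax : max (dist o (letterValue (fun a => f a * t ^ k * (f a)⁻¹) x • o))
      (dist o (letterValue (fun a => f a * t ^ k * (f a)⁻¹) y • o)) ≤
        dist o (t ^ k • o) + 2 * (dist o (f x.1 • o) + dist o (f y.1 • o)) :=
    max_le (by linarith [hlen x, @dist_nonneg _ _ o (f y.1 • o)])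
      (by linarith [hlen y, @dist_nonneg _ _ o (f x.1 • o)])
  linarith [hk x y hxy, hclose x, hclose y,
    dist_triangle4_right (f x.1 • letterValue (fun _ => t) x ^ k • o)
      (f y.1 • letterValue (fun _ => t) y ^ k • o)
      (letterValue (fun a => f a * t ^ k * (f a)⁻¹) x • o)
      (letterValue (fun a => f a * t ^ k * (f a)⁻¹) y • o)]

theorem exists_mem_forall_not_commute (ht : IsRoughAxis o t) (h : IsGromovHyperbolic X δ)
    (hG : IsUniformlyProper G X) (N : Subgroup G) [Infinite N]
    (htriv : Subgroup.zpowers t ⊓ N = ⊥) : ∃ g ∈ N, ∀ p : ℕ, 0 < p → ¬ Commute g (t ^ p) := by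
  by_contra! hcomm
  have hnear (g : N) : ∃ x ∈ Subgroup.zpowers t,
      dist ((g : G) • o) (x • o) ≤ 4 * dist o (t • o) + 10 * δ := by
    obtain ⟨p, hp, hgp⟩ := hcomm g g.2
    obtain ⟨c, hc⟩ := ht.exists_dist_zpow_smul_le_of_commute h hp hgp
    exact ⟨t ^ c, ⟨c, rfl⟩, hc⟩
  obtain ⟨x, y, hxy, hmem⟩ := hG.exists_ne_mul_inv_mem _ _ _ hnear
  have hbot : (x : G) * (y : G)⁻¹ ∈ Subgroup.zpowers t ⊓ N :=
    ⟨hmem, N.mul_mem x.2 (N.inv_mem y.2)⟩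
  rw [htriv, Subgroup.mem_bot, mul_inv_eq_one] at hbot
  exact hxy (Subtype.ext hbot)

end IsRoughAxis

end FreeSubgroups

/-- The sum of the exponents of a word in the free generators. -/
def exponentSum {α : Type*} : FreeGroup α →* Multiplicative ℤ :=
  FreeGroup.lift fun _ => Multiplicative.ofAdd 1

theorem exponentSum_of {α : Type*} (a : α) :
    exponentSum (FreeGroup.of a) = Multiplicative.ofAdd 1 :=
  FreeGroup.lift_apply_of

section NotFinitelyGenerated

theorem exists_pos_forall_mul_mem_range_intCast {A : AddSubgroup ℚ} (hA : A.FG) :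
    ∃ D : ℕ, 0 < D ∧ ∀ a ∈ A, (D : ℚ) * a ∈ (Int.castAddHom ℚ).range := by
  obtain ⟨S, rfl⟩ := hA
  refine ⟨∏ s ∈ S, s.den, Finset.prod_pos fun s _ => s.den_pos, fun a ha => ?_⟩
  suffices h : AddSubgroup.closure (S : Set ℚ) ≤
      (Int.castAddHom ℚ).range.comap (AddMonoidHom.mulLeft ((∏ s ∈ S, s.den : ℕ) : ℚ)) from h ha
  refine (AddSubgroup.closure_le _).2 fun s hs => ?_
  obtain ⟨c, hc⟩ := Finset.dvd_prod_of_mem Rat.den hs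
  refine ⟨c * s.num, ?_⟩
  rw [AddMonoidHom.coe_mulLeft, hc, Int.coe_castAddHom]
  push_cast
  rw [mul_right_comm, Rat.den_mul_eq_num, mul_comm]

theorem not_fg_of_forall_inv_two_pow_mem {A : AddSubgroup ℚ} (hA : ∀ j : ℕ, (2⁻¹ : ℚ) ^ j ∈ A) :
    ¬ A.FG := by
  intro hfg
  obtain ⟨D, hD, hint⟩ := exists_pos_forall_mul_mem_range_intCast hfg
  obtain ⟨n, hn : (n : ℚ) = D * 2⁻¹ ^ D⟩ := hint _ (hA D)
  rw [inv_pow, ← div_eq_mul_inv, eq_div_iff (by positivity)] at hn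
  have hn' : n * 2 ^ D = (D : ℤ) := by exact_mod_cast hn
  have hle := Int.le_of_dvd (by exact_mod_cast hD) (Dvd.intro_left _ hn')
  exact (Nat.lt_two_pow_self (n := D)).not_ge (by exact_mod_cast hle)

/-- The action of `ℤ` on the additive group `ℚ` whose generator halves. -/
def halving : Multiplicative ℤ →* MulAut (Multiplicative ℚ) :=
  zpowersHom _ (DistribMulAction.toAddEquiv₀ ℚ (2⁻¹ : ℚ) (by norm_num)).toMultiplicative

theorem halving_ofAdd_natCast_apply (j : ℕ) (x : ℚ) :
    halving (Multiplicative.ofAdd (j : ℤ)) (Multiplicative.ofAdd x) =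
      Multiplicative.ofAdd (2⁻¹ ^ j * x) := by
  rw [halving, zpowersHom_apply, toAdd_ofAdd, zpow_natCast]
  induction j with
  | zero => simp
  | succ j ih => rw [pow_succ', MulAut.mul_apply, ih, pow_succ', mul_assoc]; rfl

variable {α : Type*} {a b : α}

/-- The homomorphism to `ℚ ⋊ ℤ`, where `ℤ` acts by halving, that sends `b` to `(1, 1)` and the other
generators to `(0, 1)`. -/
noncomputable def halvingHom (b : α) :
    FreeGroup α →* Multiplicative ℚ ⋊[halving] Multiplicative ℤ :=
  open Classical in
  FreeGroup.lift fun c =>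
    SemidirectProduct.inl (Multiplicative.ofAdd (if c = b then 1 else 0 : ℚ)) *
      SemidirectProduct.inr (Multiplicative.ofAdd (1 : ℤ))

theorem rightHom_comp_halvingHom (b : α) :
    SemidirectProduct.rightHom.comp (halvingHom b) = exponentSum :=
  FreeGroup.ext_hom _ _ fun c => by simp [halvingHom, exponentSum_of]

theorem halvingHom_conj_pow (hab : a ≠ b) (j : ℕ) :
    halvingHom b (FreeGroup.of a ^ j * (FreeGroup.of b * (FreeGroup.of a)⁻¹) *
      (FreeGroup.of a ^ j)⁻¹) = SemidirectProduct.inl (Multiplicative.ofAdd (2⁻¹ ^ j)) := by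
  have ha : halvingHom b (FreeGroup.of a) =
      SemidirectProduct.inr (Multiplicative.ofAdd (1 : ℤ)) := by
    simp [halvingHom, hab]
  have hb : halvingHom b (FreeGroup.of b) = SemidirectProduct.inl (Multiplicative.ofAdd (1 : ℚ)) *
      SemidirectProduct.inr (Multiplicative.ofAdd (1 : ℤ)) := by
    simp [halvingHom]
  have hj : (Multiplicative.ofAdd (1 : ℤ)) ^ j = Multiplicative.ofAdd (j : ℤ) := by
    rw [← ofAdd_nsmul, nsmul_one]
  simp only [map_mul, map_inv, map_pow, ha, hb, mul_inv_cancel_right]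
  rw [← map_pow, ← map_inv, ← SemidirectProduct.inl_aut, hj, halving_ofAdd_natCast_apply, mul_one]

theorem not_fg_of_le_ker_exponentSum (hab : a ≠ b) {P : Subgroup (FreeGroup α)}
    (hker : P ≤ exponentSum.ker)
    (hmem : ∀ j : ℕ, FreeGroup.of a ^ j * (FreeGroup.of b * (FreeGroup.of a)⁻¹) *
      (FreeGroup.of a ^ j)⁻¹ ∈ P) : ¬ P.FG := by
  intro hfg
  set A : Subgroup (Multiplicative ℚ) := (P.map (halvingHom b)).comap SemidirectProduct.inl
  have hmap : A.map SemidirectProduct.inl = P.map (halvingHom b) := by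
    refine Subgroup.map_comap_eq_self ?_
    rwa [SemidirectProduct.range_inl_eq_ker_rightHom, Subgroup.map_le_iff_le_comap,
      MonoidHom.comap_ker, rightHom_comp_halvingHom]
  have hAfg : A.FG := by
    rw [Subgroup.fg_iff_submonoid_fg] at hfg ⊢
    refine Submonoid.FG.map_injective _ (SemidirectProduct.inl_injective (φ := halving)) ?_
    rw [← Subgroup.map_toSubmonoid, hmap]
    exact hfg.map _
  refine not_fg_of_forall_inv_two_pow_mem (A := Subgroup.toAddSubgroup' A) (fun j => ?_) ?_
  · exact ⟨_, hmem j, halvingHom_conj_pow hab j⟩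
  · exact (Subgroup.fg_iff_add_fg _).1 hAfg

end NotFinitelyGenerated

section ConjugatedInto

variable {G : Type*} [Group G] {N : Subgroup G} {s t g : G}

theorem pow_conj_mem (hconj : ∀ n ∈ N, t * n * t⁻¹ ∈ N) (p : ℕ) :
    ∀ n ∈ N, t ^ p * n * (t ^ p)⁻¹ ∈ N := by
  induction p with
  | zero => simp
  | succ p ih =>
    intro n hn
    simpa only [pow_succ', mul_inv_rev, mul_assoc] using hconj _ (ih n hn)

theorem commute_pow_natAbs_of_conj_mem_zpowers (hconj : ∀ n ∈ N, t * n * t⁻¹ ∈ N)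
    (htriv : Subgroup.zpowers t ⊓ N = ⊥) (hg : g ∈ N) {p : ℤ}
    (hp : g * t ^ p * g⁻¹ ∈ Subgroup.zpowers t) : Commute g (t ^ p.natAbs) := by
  have hp' : g * t ^ p.natAbs * g⁻¹ ∈ Subgroup.zpowers t := by
    rcases p.natAbs_eq with h | h <;> rw [h] at hp
    · rwa [zpow_natCast] at hp
    · rw [← inv_mem_iff] at hp
      simpa only [zpow_neg, zpow_natCast, mul_inv_rev, inv_inv, mul_assoc] using hp
  have hN : g * t ^ p.natAbs * g⁻¹ * (t ^ p.natAbs)⁻¹ ∈ N := by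
    simpa only [mul_assoc] using N.mul_mem hg (pow_conj_mem hconj p.natAbs _ (N.inv_mem hg))
  have hbot : g * t ^ p.natAbs * g⁻¹ * (t ^ p.natAbs)⁻¹ ∈ Subgroup.zpowers t ⊓ N :=
    ⟨(Subgroup.zpowers t).mul_mem hp' (inv_mem (Subgroup.npow_mem_zpowers t _)), hN⟩
  rwa [htriv, Subgroup.mem_bot, mul_inv_eq_one, mul_inv_eq_iff_eq_mul] at hbot

/-- The union of the conjugates `s⁻ᵖ N sᵖ` over `p : ℕ`. It is meant for `s` with `s N s⁻¹ ≤ N`,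
when the union is ascending and `s` normalizes it. -/
def conjUnion (s : G) (N : Subgroup G) : Subgroup G :=
  ⨆ p : ℕ, N.comap (MulAut.conj (s ^ p)).toMonoidHom

theorem mem_conjUnion (hconj : ∀ n ∈ N, s * n * s⁻¹ ∈ N) {x : G} :
    x ∈ conjUnion s N ↔ ∃ p : ℕ, s ^ p * x * (s ^ p)⁻¹ ∈ N := by
  refine Subgroup.mem_iSup_of_directed (Monotone.directed_le (monotone_nat_of_le_succ ?_))
  intro p x hx
  simpa [pow_succ', mul_assoc] using hconj _ hx

theorem le_conjUnion (s : G) (N : Subgroup G) : N ≤ conjUnion s N :=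
  le_iSup_of_le 0 fun x hx => by simpa

theorem mem_normalizer_conjUnion (hconj : ∀ n ∈ N, s * n * s⁻¹ ∈ N) :
    s ∈ Subgroup.normalizer (conjUnion s N : Set G) := by
  refine Subgroup.mem_normalizer_iff.2 fun x => ?_
  rw [mem_conjUnion hconj, mem_conjUnion hconj]
  constructor
  · rintro ⟨p, hp⟩
    refine ⟨p, ?_⟩
    have hsucc : s ^ (p + 1) * x * (s ^ (p + 1))⁻¹ ∈ N := by
      simpa only [pow_succ', mul_inv_rev, mul_assoc] using hconj _ hp
    simpa only [pow_succ, mul_inv_rev, mul_assoc] using hsucc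
  · rintro ⟨p, hp⟩
    exact ⟨p + 1, by simpa only [pow_succ, mul_inv_rev, mul_assoc] using hp⟩

theorem zpowers_inf_conjUnion (hconj : ∀ n ∈ N, s * n * s⁻¹ ∈ N)
    (htriv : Subgroup.zpowers s ⊓ N = ⊥) : Subgroup.zpowers s ⊓ conjUnion s N = ⊥ := by
  rw [eq_bot_iff, ← htriv]
  rintro _ ⟨⟨q, rfl⟩, hq⟩
  obtain ⟨p, hp⟩ := (mem_conjUnion hconj).1 hq
  refine ⟨⟨q, rfl⟩, ?_⟩
  rwa [((Commute.refl s).pow_left p |>.zpow_right q).eq, mul_inv_cancel_right] at hp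

theorem map_mul_map_inv_mem {α : Type*} {f f' : FreeGroup α →* G} {V : Subgroup G}
    (hV : ∀ w, f' w ∈ Subgroup.normalizer (V : Set G))
    (hof : ∀ a, f (FreeGroup.of a) * (f' (FreeGroup.of a))⁻¹ ∈ V) (w : FreeGroup α) :
    f w * (f' w)⁻¹ ∈ V := by
  induction w using FreeGroup.induction_on with
  | C1 => simp
  | of a => exact hof a
  | inv_of a ha =>
    simpa [mul_assoc] using (Subgroup.mem_normalizer_iff.1 (hV (FreeGroup.of a)⁻¹) _).1 (inv_mem ha)
  | mul v w hv hw =>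
    simpa [mul_assoc] using V.mul_mem hv ((Subgroup.mem_normalizer_iff.1 (hV v) _).1 hw)

theorem conj_mul_inv_mem (hconj : ∀ n ∈ N, s * n * s⁻¹ ∈ N) (hg : g ∈ N) :
    g * s * g⁻¹ * s⁻¹ ∈ N := by
  simpa only [mul_assoc] using N.mul_mem hg (hconj _ (N.inv_mem hg))

variable {α : Type*} {h : α → G}

theorem comap_lift_le_ker_exponentSum (hs : ¬ IsOfFinOrder s) (hconj : ∀ n ∈ N, s * n * s⁻¹ ∈ N)
    (htriv : Subgroup.zpowers s ⊓ N = ⊥) (hN : ∀ a, h a ∈ N) :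
    N.comap (FreeGroup.lift fun a => h a * s * (h a)⁻¹) ≤ exponentSum.ker := by
  intro w hw
  set e : FreeGroup α →* G := (zpowersHom G s).comp exponentSum
  have he (v : FreeGroup α) : e v ∈ Subgroup.zpowers s := ⟨_, rfl⟩
  have hnormalizer : Subgroup.zpowers s ≤ Subgroup.normalizer (conjUnion s N : Set G) :=
    Subgroup.zpowers_le.2 (mem_normalizer_conjUnion hconj)
  have hmem : FreeGroup.lift (fun a => h a * s * (h a)⁻¹) w * (e w)⁻¹ ∈ conjUnion s N := by
    refine map_mul_map_inv_mem (fun v => hnormalizer (he v)) (fun a => le_conjUnion s N ?_) w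
    simpa [e, exponentSum_of] using conj_mul_inv_mem hconj (hN a)
  rw [Subgroup.mul_mem_cancel_left _ (le_conjUnion s N hw), inv_mem_iff] at hmem
  have hew : e w ∈ Subgroup.zpowers s ⊓ conjUnion s N := ⟨he w, hmem⟩
  rw [zpowers_inf_conjUnion hconj htriv, Subgroup.mem_bot] at hew
  exact injective_zpow_iff_not_isOfFinOrder.2 hs (hew.trans (zpow_zero s).symm)

theorem not_hasFGIP_of_lift_injective [Finite α] [Nontrivial α] (hfg : N.FG)
    (hs : ¬ IsOfFinOrder s) (hconj : ∀ n ∈ N, s * n * s⁻¹ ∈ N)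
    (htriv : Subgroup.zpowers s ⊓ N = ⊥) (hN : ∀ a, h a ∈ N)
    (hinj : Function.Injective (FreeGroup.lift fun a => h a * s * (h a)⁻¹)) : ¬ HasFGIP G := by
  intro hG
  obtain ⟨a, b, hab⟩ := exists_pair_ne α
  set f : FreeGroup α →* G := FreeGroup.lift fun a => h a * s * (h a)⁻¹
  refine not_fg_of_le_ker_exponentSum hab
    (comap_lift_le_ker_exponentSum hs hconj htriv hN) (fun j => ?_) ?_
  · have hconj' : ∀ n ∈ N, f (FreeGroup.of a) * n * (f (FreeGroup.of a))⁻¹ ∈ N := by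
      intro n hn
      have := N.mul_mem (N.mul_mem (hN a) (hconj _ (N.mul_mem (N.mul_mem (N.inv_mem (hN a)) hn)
        (hN a)))) (N.inv_mem (hN a))
      simpa [f, mul_assoc] using this
    have hba : f (FreeGroup.of b) * (f (FreeGroup.of a))⁻¹ ∈ N := by
      simpa [f, mul_assoc] using N.mul_mem (conj_mul_inv_mem hconj (hN b))
        (N.inv_mem (conj_mul_inv_mem hconj (hN a)))
    rw [Subgroup.mem_comap]
    simpa only [map_mul, map_inv, map_pow] using pow_conj_mem hconj' j _ hba
  · have hmap : (f.range ⊓ N).FG :=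
      hG _ _ ((Group.fg_iff_subgroup_fg _).1 (Group.fg_range f)) hfg
    rw [← Subgroup.map_comap_eq, Subgroup.fg_iff_submonoid_fg] at hmap
    exact (Subgroup.fg_iff_submonoid_fg _).2 (Submonoid.FG.map_injective f hinj hmap)

end ConjugatedInto

section WordMetric

variable {G : Type*} [Group G]

theorem wordDist_mul_left_le {S : Set G} (hS : Subgroup.closure S = ⊤) (g x y : G) :
    wordDist S (g * x) (g * y) ≤ wordDist S x y := by
  obtain ⟨p, hp⟩ := (mulCayley_connected_of_closure_eq_top hS).exists_walk_length_eq_dist x y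
  let φ : SimpleGraph.mulCayley S →g SimpleGraph.mulCayley S :=
    ⟨fun a => g * a, fun h => SimpleGraph.mulCayley_adj_mul_iff_right.2 h⟩
  have := SimpleGraph.dist_le (p.map φ)
  rwa [SimpleGraph.Walk.length_map, hp] at this

theorem wordDist_mul_left {S : Set G} (hS : Subgroup.closure S = ⊤) (g x y : G) :
    wordDist S (g * x) (g * y) = wordDist S x y := by
  refine (wordDist_mul_left_le hS g x y).antisymm ?_
  simpa only [inv_mul_cancel_left] using wordDist_mul_left_le hS g⁻¹ (g * x) (g * y)

theorem exists_wordDist_eq_and_eq_sub {S : Set G} (hS : Subgroup.closure S = ⊤) (x y : G) {n : ℕ}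
    (hn : n ≤ wordDist S x y) :
    ∃ m, wordDist S x m = n ∧ wordDist S m y = wordDist S x y - n := by
  have hc := mulCayley_connected_of_closure_eq_top hS
  obtain ⟨p, hp⟩ := hc.exists_walk_length_eq_dist x y
  have h1 := SimpleGraph.dist_le (p.take n)
  have h2 := SimpleGraph.dist_le (p.drop n)
  have h3 := hc.dist_triangle (u := x) (v := p.getVert n) (w := y)
  rw [SimpleGraph.Walk.take_length] at h1
  rw [SimpleGraph.Walk.drop_length] at h2
  refine ⟨p.getVert n, ?_⟩
  unfold wordDist at *
  omega

theorem finite_setOf_wordDist_le {S : Set G} (hfin : S.Finite) (hS : Subgroup.closure S = ⊤)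
    (n : ℕ) : {x | wordDist S 1 x ≤ n}.Finite := by
  induction n with
  | zero =>
    refine (Set.finite_singleton (1 : G)).subset fun x hx => ?_
    exact ((mulCayley_connected_of_closure_eq_top hS).dist_eq_zero_iff.1 (Nat.le_zero.1 hx)).symm
  | succ n ih =>
    refine (ih.union (ih.image2 (· * ·) (hfin.union hfin.inv))).subset fun x hx => ?_
    rcases Nat.lt_or_ge n (wordDist S 1 x) with hlt | hle
    · obtain ⟨m, hm, hmx⟩ := exists_wordDist_eq_and_eq_sub hS 1 x hlt.le
      have hadj : (SimpleGraph.mulCayley S).Adj m x := by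
        rw [← SimpleGraph.dist_eq_one_iff_adj]
        change wordDist S m x = 1
        rw [Set.mem_ofPred_eq] at hx
        omega
      refine Or.inr ⟨m, hm.le, m⁻¹ * x, ?_, mul_inv_cancel_left m x⟩
      simpa using ((SimpleGraph.mulCayley_adj (s := S) m x).1 hadj).2
    · exact Or.inl hle

/-- A group as a pseudometric space, with the word metric of a generating set. -/
noncomputable abbrev wordPseudoMetricSpace (S : Set G) (hS : Subgroup.closure S = ⊤) :
    PseudoMetricSpace G where
  dist x y := wordDist S x y
  dist_self x := by simp [wordDist]
  dist_comm x y := by simp [wordDist, SimpleGraph.dist_comm]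
  dist_triangle x y z := by
    exact_mod_cast (mulCayley_connected_of_closure_eq_top hS).dist_triangle

theorem isIsometricSMul_word {S : Set G} (hS : Subgroup.closure S = ⊤) :
    letI := wordPseudoMetricSpace S hS
    IsIsometricSMul G G :=
  letI := wordPseudoMetricSpace S hS
  ⟨fun g => Isometry.of_dist_eq fun x y => congrArg Nat.cast (wordDist_mul_left hS g x y)⟩

theorem hasRoughMidpoints_word {S : Set G} (hS : Subgroup.closure S = ⊤) :
    letI := wordPseudoMetricSpace S hS
    HasRoughMidpoints G (1 / 2) := by
  intro x y
  obtain ⟨m, hxm, hmy⟩ := exists_wordDist_eq_and_eq_sub hS x y (Nat.div_le_self _ 2)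
  have h1 : 2 * (wordDist S x m : ℝ) ≤ wordDist S x y + 1 := by norm_cast; omega
  have h2 : 2 * (wordDist S m y : ℝ) ≤ wordDist S x y + 1 := by norm_cast; omega
  refine ⟨m, ?_, ?_⟩
  · change (wordDist S x m : ℝ) ≤ wordDist S x y / 2 + 1 / 2
    linarith
  · change (wordDist S m y : ℝ) ≤ wordDist S x y / 2 + 1 / 2
    linarith

theorem isUniformlyProper_word {S : Set G} (hfin : S.Finite) (hS : Subgroup.closure S = ⊤) :
    letI := wordPseudoMetricSpace S hS
    IsUniformlyProper G G := by
  intro r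
  have hball := finite_setOf_wordDist_le hfin hS ⌊r⌋₊
  refine ⟨{x | wordDist S 1 x ≤ ⌊r⌋₊}.ncard, fun x => ?_⟩
  rw [hball.cast_ncard_eq]
  refine Set.encard_le_encard_of_injOn (f := fun g => x⁻¹ * g * x) (fun g hg => ?_)
    fun g _ g' _ => by simp
  have hdist := wordDist_mul_left hS x⁻¹ x (g * x)
  rw [inv_mul_cancel, ← mul_assoc] at hdist
  rw [Set.mem_ofPred_eq, hdist]
  exact Nat.le_floor hg

end WordMetric

theorem mainTheorem6_general {G X : Type*} [Group G] [PseudoMetricSpace X] [MulAction G X]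
    [IsIsometricSMul G X] [Nonempty X] {δ C : ℝ} (h : IsGromovHyperbolic X δ)
    (hmid : HasRoughMidpoints X C) (hG : IsUniformlyProper G X)
    {N : Subgroup G} [Infinite N] (hNfg : N.FG) {t : G} (ht : ¬ IsOfFinOrder t)
    (hconj : ∀ n ∈ N, t * n * t⁻¹ ∈ N) (htriv : Subgroup.zpowers t ⊓ N = ⊥) : ¬ HasFGIP G := by
  have htriv' (i : ℕ) : Subgroup.zpowers (t ^ i) ⊓ N = ⊥ := by
    rw [eq_bot_iff, ← htriv]
    exact inf_le_inf_right N (Subgroup.zpowers_le.2 (Subgroup.npow_mem_zpowers t i))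
  obtain ⟨i, o, hi, hdist⟩ := exists_dist_pow_smul_add_le h hmid hG ht
    (Classical.arbitrary X) (4 * δ + 1)
  have haxis : IsRoughAxis o (t ^ i) := h.isRoughAxis (by rw [← pow_mul']; linarith)
  obtain ⟨g, hgN, hg⟩ := haxis.exists_mem_forall_not_commute h hG N (htriv' i)
  let f : Bool → G := fun b => cond b g 1
  have hf (b : Bool) : f b ∈ N := by cases b <;> simp [f, hgN]
  have hnot (a b : Bool) (hab : a ≠ b) (p : ℤ) (hp : p ≠ 0) :
      (f a)⁻¹ * f b * (t ^ i) ^ p * ((f a)⁻¹ * f b)⁻¹ ∉ Subgroup.zpowers (t ^ i) := by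
    intro hmem
    have hcomm := commute_pow_natAbs_of_conj_mem_zpowers (pow_conj_mem hconj i) (htriv' i)
      (N.mul_mem (N.inv_mem (hf a)) (hf b)) hmem
    refine hg _ (Int.natAbs_pos.2 hp) ?_
    cases a <;> cases b <;> simp_all [f]
  obtain ⟨k, hinj, hk⟩ := ((haxis.eventually_lift_injective h hG hnot).and
    (Filter.eventually_gt_atTop 0)).exists
  have hik : ¬ IsOfFinOrder (t ^ (i * k)) := fun hfin =>
    ht ((isOfFinOrder_pow.1 hfin).resolve_right (mul_pos hi hk).ne')
  simp only [← pow_mul] at hinj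
  exact not_hasFGIP_of_lift_injective hNfg hik (pow_conj_mem hconj _) (htriv' _) hf hinj

theorem mainTheorem6 {G : Type*} [Group G] (hG : IsHyperbolicGroup G)
    (N : Subgroup G) (hNfg : N.FG) (hNinf : Infinite N)
    (t : G) (ht : ¬ IsOfFinOrder t)
    (hconj : ∀ n ∈ N, t * n * t⁻¹ ∈ N)
    (htriv : Subgroup.zpowers t ⊓ N = ⊥) :
    ¬ HasFGIP G := by
  obtain ⟨S, hS, δ, hδ⟩ := hG
  let _ := wordPseudoMetricSpace (S : Set G) hS
  have := isIsometricSMul_word hS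
  exact mainTheorem6_general hδ (hasRoughMidpoints_word hS)
    (isUniformlyProper_word S.finite_toSet hS) hNfg ht hconj htriv
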